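/- Let $A$ be a simple Euclidean Jordan algebra of rank $3$ over $\mathbb R$ (finite-dimensional, with unit $e$), and let $c_1,c_2,c_3$ be a complete system of mutually orthogonal primitive idempotents: $c_ic_j=\delta_{ij}c_i$, $c_1+c_2+c_3=e$, and no $c_j$ is zero or a sum of two nonzero idempotents. Every $x\in A$ can be written as $x=k(\lambda_1c_1+\lambda_2c_2+\lambda_3c_3)$ with $k$ an automorphism of $A$ and real numbers $\lambda_1,\lambda_2,\lambda_3$, which are unique up to order; put $\operatorname{tr}(x)=\lambda_1+\lambda_2+\lambda_3$, $\det(x)=\lambda_1\lambda_2\lambda_3$, $(x,y)=\operatorname{tr}(xy)$ and $\|x\|^2=(x,x)$. Let $e_0=c_1+c_2$ and let $A_{1/2}=\{\xi\in A: c_3\xi=\tfrac12\xi\}$. Then for all $\xi\in A_{1/2}$ and all $t\in\mathbb R$, the element $y=e_0+\xi+t\,c_3$ satisfies $$\det(y)=t-\tfrac12\|\xi\|^2 .$$ -/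

import Mathlib

/-!
Real Euclidean Jordan algebras are modelled as finite-dimensional real vector spaces `A` with a
commutative, unital, bilinear, not necessarily associative product (`NonAssocCommRing A`,
`IsScalarTower ℝ A A`, `SMulCommClass ℝ A A`) which satisfies the Jordan identity
(`IsCommJordan A`).
-/

namespace JordanAlg

section Basic

variable (A : Type*) [NonAssocCommRing A] [Module ℝ A]

/-- The algebra is Euclidean: it carries a positive definite symmetric bilinear form which is
associative, i.e. for which all multiplication operators are self-adjoint. -/
def IsEuclidean : Prop :=
  ∃ B : A →ₗ[ℝ] A →ₗ[ℝ] ℝ,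
    (∀ x y, B x y = B y x) ∧ (∀ x, x ≠ 0 → 0 < B x x) ∧
      ∀ x u v, B (x * u) v = B u (x * v)

variable {A}

/-- Powers `x ^ m` in the (power associative) algebra `A`. -/
def pow (x : A) : ℕ → A
  | 0 => 1
  | m + 1 => x * pow x m

/-- The degree of the minimal polynomial of `x`, i.e. the dimension of `ℝ[x]`. -/
noncomputable def degree (x : A) : ℕ :=
  Module.finrank ℝ (Submodule.span ℝ (Set.range (pow x)))

variable (A) in
/-- The rank of `A`: the largest degree of the minimal polynomial of an element. -/
noncomputable def rank : ℕ :=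
  sSup (Set.range (degree : A → ℕ))

end Basic

section Frames

variable {A : Type*} [NonAssocCommRing A]

/-- A primitive idempotent: a nonzero idempotent which is not the sum of two nonzero
idempotents. -/
structure IsPrimitive (c : A) : Prop where
  idem : c * c = c
  ne_zero : c ≠ 0
  indecomposable : ∀ a b : A, a * a = a → b * b = b → a + b = c → a = 0 ∨ b = 0

/-- A complete system of three mutually orthogonal primitive idempotents. -/
structure IsFrame (c : Fin 3 → A) : Prop where
  primitive : ∀ i, IsPrimitive (c i)
  orthogonal : ∀ i j, i ≠ j → c i * c j = 0
  complete : c 0 + c 1 + c 2 = 1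

end Frames

section Spectral

variable {A : Type*} [NonAssocCommRing A] [Module ℝ A]

/-- `x = k (l₀ c₀ + l₁ c₁ + l₂ c₂)` for some automorphism `k` of the algebra `A`. -/
def HasSpectrum (c : Fin 3 → A) (x : A) (l : Fin 3 → ℝ) : Prop :=
  ∃ k : A ≃ₗ[ℝ] A, (∀ a b, k (a * b) = k a * k b) ∧
    x = k (l 0 • c 0 + l 1 • c 1 + l 2 • c 2)

open Classical in
/-- The eigenvalues of `x`, in some order, repeated according to their multiplicities. -/
noncomputable def eigenvalues (c : Fin 3 → A) (x : A) : Fin 3 → ℝ :=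
  if h : ∃ l, HasSpectrum c x l then h.choose else 0

/-- The trace: the sum of the eigenvalues. -/
noncomputable def tr (c : Fin 3 → A) (x : A) : ℝ :=
  eigenvalues c x 0 + eigenvalues c x 1 + eigenvalues c x 2

/-- The determinant: the product of the eigenvalues. -/
noncomputable def det (c : Fin 3 → A) (x : A) : ℝ :=
  eigenvalues c x 0 * eigenvalues c x 1 * eigenvalues c x 2

/-- The trace inner product `(x, y) = tr (x y)`. -/
noncomputable def trInner (c : Fin 3 → A) (x y : A) : ℝ :=
  tr c (x * y)

/-- The squared norm `‖x‖² = (x, x)` of the trace inner product. -/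
noncomputable def normSq (c : Fin 3 → A) (x : A) : ℝ :=
  trInner c x x

/-- The Peirce space `A_α` of `c`: the eigenspace of `L(c) : x ↦ c x` for the eigenvalue `α`. -/
def peirceSpace [SMulCommClass ℝ A A] (c : A) (α : ℝ) : Submodule ℝ A :=
  Module.End.eigenspace (LinearMap.mulLeft ℝ c) α

end Spectral

end JordanAlg

/-! The functional τ(x) = Tr L(x) is invariant under automorphisms and associative, since
commutators have trace zero. Simplicity makes τ equal on the three `c i`, so the traces of x, x², x³
are the power sums of any spectrum of x times τ(c 0) > 0 (`HasSpectrum.mulTrace_powers`). Peirce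
relations give these traces for y, and Newton's identity turns the power sums into the determinant,
whichever spectrum was chosen.

That a spectrum exists (`IsFrame.exists_hasSpectrum`) is variational. Maximizing (kx, h) over
isometric automorphisms k makes L(kx) commute with L(h). For h generic in the span of the frame,
each kx · `c i` then lies in A₁(`c i`), which is a line because `c i` is primitive
(`eq_smul_of_isPrimitive`). -/

/-! ### Variational arguments in an inner product space -/

section Variational

open scoped InnerProductSpace

variable {E : Type*} [NormedAddCommGroup E] [InnerProductSpace ℝ E] [FiniteDimensional ℝ E]

/-- A cubic form `⟪x, x²⟫` on the unit sphere of a subalgebra has a maximum, and a maximum is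
proportional to an idempotent. -/
theorem exists_max_cubicForm (m : E →ₗ[ℝ] E →ₗ[ℝ] E) (hcomm : ∀ x y, m x y = m y x)
    (hassoc : ∀ x u v, ⟪m x u, v⟫_ℝ = ⟪u, m x v⟫_ℝ) (U : Submodule ℝ E)
    (hU : ∀ x ∈ U, ∀ y ∈ U, m x y ∈ U) (e : E) (he : e ∈ U) (he0 : e ≠ 0) (hee : m e e = e) :
    ∃ x ∈ U, ∃ l : ℝ, 0 < l ∧ ‖x‖ = 1 ∧ m x x = l • x ∧
      ∀ y ∈ U, ⟪y, m y y⟫_ℝ ≤ l * ‖y‖ ^ 3 := by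
  have hcont : Continuous fun y : E ↦ ⟪y, m y y⟫_ℝ := by
    have h2 : Continuous fun y : E ↦ m.toContinuousBilinearMap y y := by fun_prop
    exact continuous_id.inner h2
  have hcpt : IsCompact (Metric.sphere (0 : E) 1 ∩ U) := by
    have := FiniteDimensional.proper ℝ E
    exact (isCompact_sphere 0 1).inter_right U.closed_of_finiteDimensional
  have hunit : ∀ y ∈ U, y ≠ 0 → (‖y‖⁻¹ • y) ∈ Metric.sphere (0 : E) 1 ∩ U := by
    intro y hy hy0
    refine ⟨?_, U.smul_mem _ hy⟩
    simp [norm_smul, hy0]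
  obtain ⟨x, ⟨hx1, hxU⟩, hmax⟩ := hcpt.exists_isMaxOn ⟨_, hunit e he he0⟩ hcont.continuousOn
  have hx1 : ‖x‖ = 1 := by simpa using hx1
  set l : ℝ := ⟪x, m x x⟫_ℝ with hl
  have hbound : ∀ y ∈ U, ⟪y, m y y⟫_ℝ ≤ l * ‖y‖ ^ 3 := by
    intro y hy
    rcases eq_or_ne y 0 with rfl | hy0
    · simp
    have h := hmax (hunit y hy hy0)
    simp only [Set.mem_ofPred_eq, map_smul, LinearMap.smul_apply, inner_smul_left,
      inner_smul_right, conj_trivial] at h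
    have hn : 0 < ‖y‖ := norm_pos_iff.2 hy0
    calc ⟪y, m y y⟫_ℝ
        = (‖y‖⁻¹ * (‖y‖⁻¹ * (‖y‖⁻¹ * ⟪y, m y y⟫_ℝ))) * ‖y‖ ^ 3 := by field_simp
      _ ≤ _ := by gcongr
  have hlpos : 0 < l := by
    have h := hbound e he
    rw [hee, real_inner_self_eq_norm_sq] at h
    have hn : 0 < ‖e‖ := norm_pos_iff.2 he0
    by_contra hneg
    have : l * ‖e‖ ^ 3 ≤ 0 := mul_nonpos_of_nonpos_of_nonneg (not_lt.1 hneg) (by positivity)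
    nlinarith [sq_pos_of_pos hn]
  refine ⟨x, hxU, l, hlpos, hx1, ?_, hbound⟩
  -- v is tangent to the sphere at x; varying the cubic form along x + s v will force v = 0.
  set v : E := m x x - l • x with hv
  have hvU : v ∈ U := U.sub_mem (hU x hxU x hxU) (U.smul_mem _ hxU)
  have hxx : ⟪x, x⟫_ℝ = 1 := by rw [real_inner_self_eq_norm_sq, hx1]; norm_num
  have hxv : ⟪x, v⟫_ℝ = 0 := by
    rw [hv, inner_sub_right, inner_smul_right, hxx, ← hl]; ring
  have hβ : ⟪v, m x x⟫_ℝ = ⟪v, v⟫_ℝ := by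
    have : m x x = v + l • x := by rw [hv]; abel
    rw [this, inner_add_right, inner_smul_right, real_inner_comm x v, hxv]; ring
  have hexp : ∀ s : ℝ, ⟪x + s • v, m (x + s • v) (x + s • v)⟫_ℝ =
      l + 3 * s * ⟪v, v⟫_ℝ + 3 * s ^ 2 * ⟪x, m v v⟫_ℝ + s ^ 3 * ⟪v, m v v⟫_ℝ := by
    intro s
    simp only [map_add, map_smul, LinearMap.add_apply, LinearMap.smul_apply, inner_add_left,
      inner_add_right, inner_smul_left, inner_smul_right, conj_trivial, hcomm v x]
    rw [← hassoc x v v, real_inner_comm _ (m x v), ← hassoc x x v, real_inner_comm v (m x x), hβ,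
      ← hassoc v x v, hcomm v x, real_inner_comm v (m x v), ← hl]
    ring
  -- As ‖x + s v‖ ≥ 1, its cube may be replaced by its fourth power, which is a polynomial in s.
  have hmin : ∀ s : ℝ, 0 ≤ l * (1 + s ^ 2 * ⟪v, v⟫_ℝ) ^ 2 - (l + 3 * s * ⟪v, v⟫_ℝ +
      3 * s ^ 2 * ⟪x, m v v⟫_ℝ + s ^ 3 * ⟪v, m v v⟫_ℝ) := by
    intro s
    have hn : ‖x + s • v‖ ^ 2 = 1 + s ^ 2 * ⟪v, v⟫_ℝ := by
      rw [← real_inner_self_eq_norm_sq]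
      simp only [inner_add_left, inner_add_right, inner_smul_left, inner_smul_right,
        conj_trivial, hxx, real_inner_comm x v, hxv]
      ring
    have hge : 1 ≤ ‖x + s • v‖ := by
      have : 0 ≤ s ^ 2 * ⟪v, v⟫_ℝ := mul_nonneg (sq_nonneg s) real_inner_self_nonneg
      nlinarith [norm_nonneg (x + s • v)]
    have h := hbound _ (U.add_mem hxU (U.smul_mem s hvU))
    rw [hexp] at h
    rw [← hn, ← pow_mul, sub_nonneg]
    refine h.trans (mul_le_mul_of_nonneg_left ?_ hlpos.le)
    exact pow_le_pow_right₀ hge (by norm_num)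
  have hder : HasDerivAt (fun s : ℝ ↦ l * (1 + s ^ 2 * ⟪v, v⟫_ℝ) ^ 2 - (l + 3 * s * ⟪v, v⟫_ℝ +
      3 * s ^ 2 * ⟪x, m v v⟫_ℝ + s ^ 3 * ⟪v, m v v⟫_ℝ)) (-(3 * ⟪v, v⟫_ℝ)) 0 := by
    have h := (((((hasDerivAt_id (0 : ℝ)).pow 2).mul_const ⟪v, v⟫_ℝ).const_add 1).pow 2
      |>.const_mul l).sub ((((((hasDerivAt_id (0 : ℝ)).const_mul 3).mul_const ⟪v, v⟫_ℝ).const_add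
      l).add ((((hasDerivAt_id (0 : ℝ)).pow 2).const_mul 3).mul_const ⟪x, m v v⟫_ℝ)).add
      (((hasDerivAt_id (0 : ℝ)).pow 3).mul_const ⟪v, m v v⟫_ℝ))
    exact h.congr_deriv (by simp)
  have h0 := IsLocalMin.hasDerivAt_eq_zero (Filter.Eventually.of_forall fun s ↦ by
    simpa using hmin s) hder
  have : ⟪v, v⟫_ℝ = 0 := by linarith
  exact sub_eq_zero.1 (inner_self_eq_zero.1 this)

/-- A unital algebra with an associative inner product and without nontrivial idempotents is
one-dimensional. -/
theorem eq_smul_unit_of_idempotents_trivial (m : E →ₗ[ℝ] E →ₗ[ℝ] E)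
    (hcomm : ∀ x y, m x y = m y x) (hassoc : ∀ x u v, ⟪m x u, v⟫_ℝ = ⟪u, m x v⟫_ℝ)
    (U : Submodule ℝ E) (hU : ∀ x ∈ U, ∀ y ∈ U, m x y ∈ U) (e : E) (he : e ∈ U) (he0 : e ≠ 0)
    (hunit : ∀ x ∈ U, m e x = x) (hidem : ∀ p ∈ U, m p p = p → p = 0 ∨ p = e) :
    ∀ x ∈ U, ∃ r : ℝ, x = r • e := by
  obtain ⟨x, hxU, l, hl, hx1, hxx, hbound⟩ :=
    exists_max_cubicForm m hcomm hassoc U hU e he he0 (hunit e he)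
  have hx0 : x ≠ 0 := by rintro rfl; simp at hx1
  have hp : l⁻¹ • x = e := by
    refine (hidem _ (U.smul_mem _ hxU) ?_).resolve_left (smul_ne_zero (inv_ne_zero hl.ne') hx0)
    simp only [map_smul, LinearMap.smul_apply, hxx, smul_smul]
    congr 1
    field_simp
  have hle : l * ‖e‖ = 1 := by
    rw [← hp, norm_smul, hx1, norm_inv, Real.norm_of_nonneg hl.le]
    field_simp
  have hen : 0 < ‖e‖ := norm_pos_iff.2 he0
  -- The cubic form averages 4‖e‖² over e ± w, but the maximum l = 1/‖e‖ allows only 2√2‖e‖². Below,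
  -- √2 is bounded by 3/2.
  have horth : ∀ w ∈ U, ⟪e, w⟫_ℝ = 0 → ‖w‖ = ‖e‖ → False := by
    intro w hw hew hn
    have hexp : ∀ s : ℝ, ⟪e + s • w, m (e + s • w) (e + s • w)⟫_ℝ =
        ‖e‖ ^ 2 + 3 * s ^ 2 * ‖e‖ ^ 2 + s ^ 3 * ⟪w, m w w⟫_ℝ := by
      intro s
      have hewww : ⟪e, m w w⟫_ℝ = ‖e‖ ^ 2 := by
        rw [← hassoc, hcomm, hunit w hw, real_inner_self_eq_norm_sq, hn]
      simp only [map_add, map_smul, LinearMap.add_apply, LinearMap.smul_apply, inner_add_left,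
        inner_add_right, inner_smul_left, inner_smul_right, conj_trivial, hcomm w e, hunit w hw,
        hunit e he, hew, real_inner_comm e w, hewww, real_inner_self_eq_norm_sq, hn]
      ring
    have hnorm : ∀ s : ℝ, s ^ 2 = 1 → ‖e + s • w‖ ^ 2 = 2 * ‖e‖ ^ 2 := by
      intro s hs
      rw [← real_inner_self_eq_norm_sq]
      simp only [inner_add_left, inner_add_right, inner_smul_left, inner_smul_right,
        conj_trivial, hew, real_inner_comm e w, real_inner_self_eq_norm_sq, hn]
      linear_combination ‖e‖ ^ 2 * hs
    have hlt : ∀ s : ℝ, s ^ 2 = 1 → ‖e + s • w‖ ≤ 3 / 2 * ‖e‖ := by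
      intro s hs
      have := hnorm s hs
      refine abs_le_of_sq_le_sq' ?_ (by positivity) |>.2
      nlinarith [sq_nonneg ‖e‖]
    have key : ∀ s : ℝ, s ^ 2 = 1 →
        ‖e‖ ^ 2 + 3 * ‖e‖ ^ 2 + s ^ 3 * ⟪w, m w w⟫_ℝ ≤ 3 * ‖e‖ ^ 2 := by
      intro s hs
      have h := hbound _ (U.add_mem he (U.smul_mem s hw))
      rw [hexp, hs] at h
      have h3 : l * ‖e + s • w‖ ^ 3 ≤ 3 * ‖e‖ ^ 2 := by
        rw [pow_succ, hnorm s hs]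
        calc l * (2 * ‖e‖ ^ 2 * ‖e + s • w‖) ≤ l * (2 * ‖e‖ ^ 2 * (3 / 2 * ‖e‖)) := by
              gcongr; exact hlt s hs
          _ = 3 * ‖e‖ ^ 2 * (l * ‖e‖) := by ring
          _ = 3 * ‖e‖ ^ 2 := by rw [hle, mul_one]
      linarith
    have h1 := key 1 (by norm_num)
    have h2 := key (-1) (by norm_num)
    nlinarith [sq_pos_of_pos hen]
  intro y hy
  refine ⟨⟪e, y⟫_ℝ / ‖e‖ ^ 2, ?_⟩
  by_contra hne
  set w := y - (⟪e, y⟫_ℝ / ‖e‖ ^ 2) • e with hw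
  have hw0 : 0 < ‖w‖ := norm_pos_iff.2 (sub_ne_zero.2 hne)
  refine horth ((‖e‖ / ‖w‖) • w) (U.smul_mem _ (U.sub_mem hy (U.smul_mem _ he))) ?_ ?_
  · rw [inner_smul_right, hw, inner_sub_right, inner_smul_right, real_inner_self_eq_norm_sq]
    field_simp
    ring
  · rw [norm_smul, norm_div, norm_norm, norm_norm]
    field_simp

/-- A point of every orbit of the isometric automorphisms at which the linear form `⟪·, h⟫` is
stationary. -/
theorem exists_automorphism_stationary (m : E →ₗ[ℝ] E →ₗ[ℝ] E) (x h : E) :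
    ∃ k : E ≃ₗ[ℝ] E, (∀ a b, k (m a b) = m (k a) (k b)) ∧
      ∀ D : E →ₗ[ℝ] E, (∀ a b, D (m a b) = m (D a) b + m a (D b)) →
        (∀ a b, ⟪D a, b⟫_ℝ = -⟪a, D b⟫_ℝ) → ⟪D (k x), h⟫_ℝ = 0 := by
  let S : Set (E →L[ℝ] E) := {k | (∀ a b, k (m a b) = m (k a) (k b)) ∧ ∀ a, ‖k a‖ = ‖a‖}
  have hS : IsCompact S := by
    have := FiniteDimensional.proper ℝ (E →L[ℝ] E)
    refine Metric.isCompact_of_isClosed_isBounded ?_ ?_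
    · have heq : S = (⋂ a, ⋂ b, {k : E →L[ℝ] E | k (m a b) =
          m.toContinuousBilinearMap (k a) (k b)}) ∩ ⋂ a, {k : E →L[ℝ] E | ‖k a‖ = ‖a‖} := by
        ext k; simp [S]
      rw [heq]
      refine (isClosed_iInter fun a ↦ isClosed_iInter fun b ↦ isClosed_eq ?_ ?_).inter
        (isClosed_iInter fun a ↦ isClosed_eq ?_ ?_) <;> fun_prop
    · refine (Metric.isBounded_closedBall (x := (0 : E →L[ℝ] E)) (r := 1)).subset fun k hk ↦ ?_
      rw [mem_closedBall_zero_iff]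
      exact k.opNorm_le_bound zero_le_one fun a ↦ by rw [hk.2 a, one_mul]
  have hid : ContinuousLinearMap.id ℝ E ∈ S := ⟨fun _ _ ↦ rfl, fun _ ↦ rfl⟩
  obtain ⟨k, hk, hmax⟩ := hS.exists_isMaxOn ⟨_, hid⟩
    (f := fun k : E →L[ℝ] E ↦ ⟪k x, h⟫_ℝ) (by fun_prop)
  refine ⟨((⟨k.toLinearMap, hk.2⟩ : E →ₗᵢ[ℝ] E).toLinearIsometryEquiv rfl).toLinearEquiv,
    hk.1, fun D hD hskew ↦ ?_⟩
  have hDself : ∀ a, ⟪D a, a⟫_ℝ = 0 := fun a ↦ by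
    have := hskew a a; rw [real_inner_comm (D a) a] at this; linarith
  let T : E →L[ℝ] E := D.toContinuousLinearMap
  let g : ℝ → E →L[ℝ] E := fun t ↦ NormedSpace.exp (t • T)
  have hg : ∀ a t, HasDerivAt (fun t ↦ g t a) (D (g t a)) t := fun a t ↦ by
    have := (hasDerivAt_exp_smul_const' T t).clm_apply (hasDerivAt_const t a)
    simpa [T] using this
  have hg0 : ∀ a, g 0 a = a := fun a ↦ by simp [g]
  -- Skewness of D conserves norms along its flow. This serves twice: exp(tD) is isometric, and its
  -- failure to be multiplicative, which solves the same equation and starts at 0, stays 0.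
  have hconst : ∀ f : ℝ → E, (∀ t, HasDerivAt f (D (f t)) t) → ∀ t, ‖f t‖ = ‖f 0‖ := by
    intro f hf t
    have hd : ∀ t, HasDerivAt (fun t ↦ ⟪f t, f t⟫_ℝ) 0 t := fun t ↦ by
      have := (hf t).inner ℝ (hf t)
      rwa [real_inner_comm (D (f t)) (f t), hDself, add_zero] at this
    have := is_const_of_deriv_eq_zero (fun t ↦ (hd t).differentiableAt) (fun t ↦ (hd t).deriv) t 0
    simp only [real_inner_self_eq_norm_sq] at this
    exact (pow_left_inj₀ (norm_nonneg _) (norm_nonneg _) two_ne_zero).1 this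
  have hgS : ∀ t, g t ∘L k ∈ S := by
    refine fun t ↦ ⟨fun a b ↦ ?_, fun a ↦ ?_⟩
    · have hd : ∀ t, HasDerivAt (fun t ↦ g t (m (k a) (k b)) - m (g t (k a)) (g t (k b)))
          (D (g t (m (k a) (k b)) - m (g t (k a)) (g t (k b)))) t := by
        intro t
        have h1 := (m.toContinuousBilinearMap.hasFDerivAt.comp_hasDerivAt t
          (hg (k a) t)).clm_apply (hg (k b) t)
        have h2 := (hg (m (k a) (k b)) t).sub h1
        exact h2.congr_deriv (by simp [hD])
      have := hconst _ hd t
      simp only [hg0, sub_self, norm_zero, norm_eq_zero] at this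
      simpa [hk.1] using sub_eq_zero.1 this
    · have := hconst _ (hg (k a)) t
      simpa [hg0, hk.2] using this
  have hloc : IsLocalMax (fun t ↦ ⟪g t (k x), h⟫_ℝ) 0 := by
    refine Filter.Eventually.of_forall fun t ↦ ?_
    have := hmax (hgS t)
    simpa [hg0] using this
  have hder := (hg (k x) 0).inner ℝ (hasDerivAt_const (0 : ℝ) h)
  have := hloc.hasDerivAt_eq_zero hder
  simpa [hg0] using this

end Variational

namespace JordanAlg

/-! ### Inner derivations, the linearized Jordan identity and Peirce relations -/

section InnerDerivation

variable {A : Type*} [NonAssocCommRing A] [Module ℝ A] [SMulCommClass ℝ A A]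

/-- The inner derivation `[L(a), L(b)]`. -/
def innerDerivation (a b : A) : A →ₗ[ℝ] A :=
  LinearMap.mulLeft ℝ a * LinearMap.mulLeft ℝ b - LinearMap.mulLeft ℝ b * LinearMap.mulLeft ℝ a

theorem innerDerivation_apply (a b x : A) :
    innerDerivation a b x = a * (b * x) - b * (a * x) := rfl

end InnerDerivation

section Identities

variable {A : Type*} [NonAssocCommRing A] [Module ℝ A] [IsCommJordan A]

/-- The full linearization of the Jordan identity. -/
theorem jordan_linearized (a b c d : A) :
    a * ((b * c) * d) - (b * c) * (a * d) + (b * ((c * a) * d) - (c * a) * (b * d)) +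
      (c * ((a * b) * d) - (a * b) * (c * d)) = 0 := by
  have h := DFunLike.congr_fun (two_nsmul_lie_lmul_lmul_add_add_eq_zero a b c) d
  have h2 : (2 : ℝ) • (a * ((b * c) * d) - (b * c) * (a * d) +
      (b * ((c * a) * d) - (c * a) * (b * d)) +
      (c * ((a * b) * d) - (a * b) * (c * d))) = 0 := by
    rw [ofNat_smul_eq_nsmul]
    exact h
  exact (smul_eq_zero.1 h2).resolve_left two_ne_zero

/-- The Leibniz rule is the difference of two linearized Jordan identities with a and b exchanged.
-/
theorem innerDerivation_mul [SMulCommClass ℝ A A] (a b x y : A) :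
    innerDerivation a b (x * y) = innerDerivation a b x * y + x * innerDerivation a b y := by
  have h1 := jordan_linearized a x y b
  have h2 := jordan_linearized b x y a
  simp only [innerDerivation_apply, mul_sub, sub_mul]
  rw [← sub_eq_zero, ← sub_eq_zero.2 (h1.trans h2.symm)]
  simp only [mul_comm]
  abel

variable {c : A}

theorem mul_left_comm_of_peirce_one (hc : c * c = c) {a : A} (ha : c * a = a) (x : A) :
    c * (a * x) = a * (c * x) := by
  have h := jordan_linearized a c c x
  rw [mul_comm a c, hc, ha] at h
  rw [← sub_eq_zero, ← h]
  abel

theorem mul_left_comm_of_peirce_zero (hc : c * c = c) {a : A} (ha : c * a = 0) (x : A) :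
    c * (a * x) = a * (c * x) := by
  have h := jordan_linearized a c c x
  rw [mul_comm a c, hc, ha] at h
  simp only [zero_mul, mul_zero, sub_self, add_zero] at h
  exact (sub_eq_zero.1 h).symm

theorem peirce_cubic (hc : c * c = c) (x : A) :
    (2 : ℝ) • (c * (c * (c * x))) - (3 : ℝ) • (c * (c * x)) + c * x = 0 := by
  have h := jordan_linearized x c c c
  rw [hc, mul_comm x c, mul_comm (c * x) c, hc, mul_comm x c] at h
  rw [← h]
  module

variable [IsScalarTower ℝ A A] [SMulCommClass ℝ A A]

theorem eigenvalue_of_idempotent (hc : c * c = c) {x : A} {r : ℝ} (hx : c * x = r • x)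
    (hx0 : x ≠ 0) : r = 0 ∨ r = 1 / 2 ∨ r = 1 := by
  have h := peirce_cubic hc x
  simp only [hx, mul_smul_comm] at h
  have h2 : (r * ((2 * r - 1) * (r - 1))) • x = 0 := by rw [← h]; module
  rcases mul_eq_zero.1 ((smul_eq_zero.1 h2).resolve_right hx0) with h | h
  · exact Or.inl h
  rcases mul_eq_zero.1 h with h | h
  · exact Or.inr (Or.inl (by linarith))
  · exact Or.inr (Or.inr (by linarith))

/-- This encodes A_{1/2} · A_{1/2} ⊆ A₀ + A₁: multiplying uv by c extracts its A₁ component. -/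
theorem peirce_half_mul_half (hc : c * c = c) {u v : A} (hu : c * u = (1 / 2 : ℝ) • u)
    (hv : c * v = (1 / 2 : ℝ) • v) : c * (c * (u * v)) = c * (u * v) := by
  have h := jordan_linearized u v c c
  rw [hc, mul_comm v c, hu, hv, mul_comm (u * v) c] at h
  simp only [smul_mul_assoc, mul_smul_comm, mul_comm u c, mul_comm v c, hu, hv, mul_comm v u] at h
  rw [← sub_eq_zero, ← h]
  abel

end Identities

/-! ### The associative trace functional -/

section Trace

variable {A : Type*} [NonAssocCommRing A] [Module ℝ A] [IsScalarTower ℝ A A]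
  [SMulCommClass ℝ A A]

variable (A) in
/-- The linear functional `x ↦ Tr L(x)`. -/
noncomputable def mulTrace : A →ₗ[ℝ] ℝ :=
  LinearMap.trace ℝ A ∘ₗ LinearMap.mul ℝ A

theorem mulTrace_one [FiniteDimensional ℝ A] : mulTrace A 1 = Module.finrank ℝ A := by
  have : LinearMap.mul ℝ A 1 = LinearMap.id := by ext x; simp
  rw [mulTrace, LinearMap.comp_apply, this, LinearMap.trace_id]

theorem mulTrace_map (k : A ≃ₗ[ℝ] A) (hk : ∀ a b, k (a * b) = k a * k b) (x : A) :
    mulTrace A (k x) = mulTrace A x := by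
  have : LinearMap.mul ℝ A (k x) = k.conj (LinearMap.mul ℝ A x) := by
    ext y
    simp [LinearEquiv.conj_apply, hk]
  rw [mulTrace, LinearMap.comp_apply, this, LinearMap.trace_conj', LinearMap.comp_apply]

/-- For the derivation D = [L(d), L(a)], L(Db) = [D, L(b)] is a commutator, so it has trace zero. -/
theorem mulTrace_mul_assoc [IsCommJordan A] (a b d : A) :
    mulTrace A ((a * b) * d) = mulTrace A (a * (b * d)) := by
  have h : LinearMap.mul ℝ A (innerDerivation d a b) =
      innerDerivation d a * LinearMap.mul ℝ A b - LinearMap.mul ℝ A b * innerDerivation d a := by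
    ext x
    simp [innerDerivation_mul]
  have h2 : mulTrace A (innerDerivation d a b) = 0 := by
    rw [mulTrace, LinearMap.comp_apply, h, map_sub, LinearMap.trace_mul_comm, sub_self]
  rw [innerDerivation_apply, map_sub, sub_eq_zero] at h2
  rw [mul_comm (a * b) d, h2, mul_comm d b]

variable {c : A} [IsCommJordan A]

theorem mulTrace_peirce_half (hc : c * c = c) {u : A} (hu : c * u = (1 / 2 : ℝ) • u) :
    mulTrace A u = 0 := by
  have h := mulTrace_mul_assoc c c u
  rw [hc, hu, mul_smul_comm, hu] at h
  simp only [map_smul, smul_eq_mul] at h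
  linarith

theorem mulTrace_mul_half_sq {u : A} (hu : c * u = (1 / 2 : ℝ) • u) :
    mulTrace A (c * (u * u)) = 1 / 2 * mulTrace A (u * u) := by
  rw [← mulTrace_mul_assoc, hu, smul_mul_assoc, map_smul, smul_eq_mul]

/-- Moving c across by associativity gives ½τ(u(cu²)) = τ(u(cu²)), so this trace vanishes, and it
also equals ½τ(u³). -/
theorem mulTrace_half_cube (hc : c * c = c) {u : A} (hu : c * u = (1 / 2 : ℝ) • u) :
    mulTrace A (u * (u * u)) = 0 := by
  have hq := peirce_half_mul_half hc hu hu
  have h1 := mulTrace_mul_assoc u c (c * (u * u))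
  have h2 := mulTrace_mul_assoc u c (u * u)
  rw [mul_comm u c, hu, smul_mul_assoc, map_smul, smul_eq_mul] at h1 h2
  rw [hq] at h1
  linarith

end Trace

/-! ### Consequences of the Euclidean structure -/

section Euclidean

variable {A : Type*} [NonAssocCommRing A] [Module ℝ A] [IsScalarTower ℝ A A]
  [SMulCommClass ℝ A A] [FiniteDimensional ℝ A] [IsCommJordan A]

/-- The inner product given by a positive definite symmetric form. -/
abbrev innerCore {V : Type*} [AddCommGroup V] [Module ℝ V] (B : V →ₗ[ℝ] V →ₗ[ℝ] ℝ)
    (hsymm : ∀ x y, B x y = B y x) (hpos : ∀ x, x ≠ 0 → 0 < B x x) :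
    InnerProductSpace.Core ℝ V where
  inner x y := B x y
  conj_inner_symm x y := hsymm y x
  re_inner_nonneg x := by
    rcases eq_or_ne x 0 with rfl | h
    · simp
    · exact (hpos x h).le
  add_left x y z := by simp
  smul_left x y r := by simp
  definite x h := by
    by_contra hx
    exact (hpos x hx).ne' h

/-- A₁(c) is a subalgebra with unit c; an idempotent p in it splits c as p + (c - p), so primitivity
leaves only 0 and c. -/
theorem eq_smul_of_isPrimitive (hE : IsEuclidean A) {c : A} (hc : IsPrimitive c) {x : A}
    (hx : c * x = x) : ∃ r : ℝ, x = r • c := by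
  obtain ⟨B, hsymm, hpos, hassoc⟩ := hE
  let core := innerCore B hsymm hpos
  let _ : NormedAddCommGroup A := core.toNormedAddCommGroup
  let _ : InnerProductSpace ℝ A := InnerProductSpace.ofCore core.toCore
  have hmem : ∀ y, y ∈ peirceSpace c 1 ↔ c * y = y := fun y ↦ by
    simp [peirceSpace]
  refine eq_smul_unit_of_idempotents_trivial (LinearMap.mul ℝ A) mul_comm hassoc
    (peirceSpace c 1) ?_ c ((hmem c).2 hc.idem) hc.ne_zero (fun y hy ↦ (hmem y).1 hy) ?_
    x ((hmem x).2 hx)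
  · intro y hy z hz
    rw [hmem] at hy hz ⊢
    change c * (y * z) = y * z
    rw [mul_left_comm_of_peirce_one hc.idem hy, hz]
  · intro p hp hpp
    rw [hmem] at hp
    change p * p = p at hpp
    refine (hc.indecomposable p (c - p) hpp ?_ (by abel)).imp_right fun h ↦ (sub_eq_zero.1 h).symm
    rw [mul_sub, sub_mul, sub_mul, hc.idem, mul_comm p c, hp, hpp]
    abel

/-- Every orbit of the automorphism group contains an element that operator commutes with `h`. -/
theorem exists_automorphism_mul_left_comm (hE : IsEuclidean A) (x h : A) :
    ∃ k : A ≃ₗ[ℝ] A, (∀ a b, k (a * b) = k a * k b) ∧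
      ∀ a, k x * (h * a) = h * (k x * a) := by
  obtain ⟨B, hsymm, hpos, hassoc⟩ := hE
  let core := innerCore B hsymm hpos
  let _ : NormedAddCommGroup A := core.toNormedAddCommGroup
  let _ : InnerProductSpace ℝ A := InnerProductSpace.ofCore core.toCore
  obtain ⟨k, hk, hcrit⟩ := exists_automorphism_stationary (LinearMap.mul ℝ A) x h
  refine ⟨k, hk, fun a ↦ ?_⟩
  -- Stationarity along [L(a), L(b)], rewritten by self-adjointness as a statement about [L(kx),
  -- L(h)].
  have key : ∀ b, B b (k x * (h * a) - h * (k x * a)) = 0 := by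
    intro b
    have h1 : B (a * (b * k x) - b * (a * k x)) h = 0 :=
      hcrit (innerDerivation a b) (innerDerivation_mul a b) fun y z ↦ by
        change B (a * (b * y) - b * (a * y)) z = -B y (a * (b * z) - b * (a * z))
        rw [map_sub, LinearMap.sub_apply, hassoc, hassoc, hassoc, hassoc, map_sub]
        ring
    rw [map_sub, LinearMap.sub_apply, hassoc a, hassoc b (a * k x), mul_comm b (k x),
      hassoc (k x), hsymm (a * k x) (b * h), mul_comm b h, hassoc h] at h1
    rw [map_sub, mul_comm h a, mul_comm (k x) a]
    exact h1
  by_contra hne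
  exact (hpos _ (sub_ne_zero.2 hne)).ne' (key _)

end Euclidean

/-! ### Existence of the spectrum -/

section FrameSpectrum

variable {A : Type*} [NonAssocCommRing A] [Module ℝ A] [IsScalarTower ℝ A A]
  [SMulCommClass ℝ A A] [IsCommJordan A]

/-- The eigenspace of `L(a₀ e₀ + a₁ e₁ + a₂ e₂)` for the eigenvalue `a₀` lies in the Peirce space
`A₁(e₀)` when the `aᵢ` are in general position. -/
theorem peirce_one_of_eigenvector {e f g : A} (he : e * e = e) (hf : f * f = f)
    (hef : e * f = 0) (hsum : e + f + g = 1) {a b d : ℝ}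
    (hab : a ≠ b) (had : a ≠ d) (hbd : b ≠ d) (hb : 2 * b ≠ a + d) (ha : 2 * a ≠ b + d) {w : A}
    (hw : a • (e * w) + b • (f * w) + d • (g * w) = a • w) : e * w = w := by
  have hbd' : b - d ≠ 0 := sub_ne_zero.2 hbd
  have hg : ∀ x, g * x = x - e * x - f * x := fun x ↦ by
    have : (e + f + g) * x = x := by rw [hsum, one_mul]
    rw [add_mul, add_mul] at this
    rw [← sub_eq_zero, ← sub_eq_zero.2 this]
    abel
  have hcomm : ∀ x, f * (e * x) = e * (f * x) := fun x ↦
    (mul_left_comm_of_peirce_zero he hef x).symm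
  have hfw : (b - d) • (f * w) = (a - d) • w - (a - d) • (e * w) := by
    rw [hg] at hw
    rw [← sub_eq_zero, ← sub_eq_zero.2 hw]
    module
  have hfw : f * w = ((a - d) / (b - d)) • (w - e * w) := by
    rw [← inv_smul_smul₀ hbd' (f * w), hfw]
    module
  have hcub := peirce_cubic he w
  set w1 := e * w with hw1
  set w2 := e * w1 with hw2
  have he2 : e * w2 = (3 / 2 : ℝ) • w2 - (1 / 2 : ℝ) • w1 := by
    have : e * w2 = (1 / 2 : ℝ) • ((2 : ℝ) • (e * w2)) := by module
    rw [this, ← sub_eq_zero]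
    have h : (2 : ℝ) • (e * w2) = (3 : ℝ) • w2 - w1 := by
      rw [← sub_eq_zero, ← hcub]; module
    rw [h]; module
  -- The general position hypotheses say exactly that s avoids 0, 1, 2 and 1/2.
  set s := (a - d) / (b - d) with hs
  have hfw1 : f * w1 = s • (w1 - w2) := by
    rw [hw1, hcomm, hfw, mul_smul_comm, mul_sub]
  have hfw2 : f * w2 = s • (w2 - e * w2) := by
    rw [hw2, hcomm, hfw1, mul_smul_comm, mul_sub]
  have hs0 : s ≠ 0 := div_ne_zero (sub_ne_zero.2 had) hbd'
  have hs1 : s ≠ 1 := fun h ↦ hab (by rw [hs, div_eq_one_iff_eq hbd'] at h; linarith)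
  have hs2 : s ≠ 2 := fun h ↦ hb (by rw [hs, div_eq_iff hbd'] at h; linarith)
  have hs3 : s ≠ 1 / 2 := fun h ↦ ha (by rw [hs, div_eq_iff hbd'] at h; linarith)
  -- This is a quarter of the A_{1/2}(e) component of w, where f acts by s/2. The combination in
  -- `hzero` is the A₀(e) component, where f acts by s. Neither value is a Peirce eigenvalue.
  have hhalf : w1 - w2 = 0 := by
    by_contra hne
    have : f * (w1 - w2) = (s / 2) • (w1 - w2) := by
      rw [mul_sub, hfw1, hfw2, he2]; module
    rcases eigenvalue_of_idempotent hf this hne with h | h | h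
    · exact hs0 (by linarith)
    · exact hs1 (by linarith)
    · exact hs2 (by linarith)
  have hzero : w - (3 : ℝ) • w1 + (2 : ℝ) • w2 = 0 := by
    by_contra hne
    have : f * (w - (3 : ℝ) • w1 + (2 : ℝ) • w2) = s • (w - (3 : ℝ) • w1 + (2 : ℝ) • w2) := by
      rw [mul_add, mul_sub, mul_smul_comm, mul_smul_comm, hfw, hfw1, hfw2, he2]; module
    rcases eigenvalue_of_idempotent hf this hne with h | h | h
    · exact hs0 h
    · exact hs3 h
    · exact hs1 h
  rw [← sub_eq_zero.1 hhalf] at hzero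
  rw [← sub_eq_zero, ← neg_eq_zero, ← hzero]
  module

variable {c : Fin 3 → A}

/-- Every element is conjugate under the automorphism group to an element of the span of a frame. -/
theorem IsFrame.exists_hasSpectrum [FiniteDimensional ℝ A] (hc : IsFrame c) (hE : IsEuclidean A)
    (x : A) : ∃ l, HasSpectrum c x l := by
  -- The weights 0, 1, 3 are distinct and none is the midpoint of the others. Commutation makes kx ·
  -- `c i` an eigenvector of L(h) for the weight of `c i`.
  obtain ⟨k, hk, hcomm⟩ := exists_automorphism_mul_left_comm hE x ((1 : ℝ) • c 1 + (3 : ℝ) • c 2)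
  have o := hc.orthogonal
  have i := fun j ↦ (hc.primitive j).idem
  have hs := hc.complete
  have h0 : c 0 * (k x * c 0) = k x * c 0 := by
    refine peirce_one_of_eigenvector (i 0) (i 1) (o 0 1 (by decide)) hs
      (a := 0) (b := 1) (d := 3) (by norm_num) (by norm_num) (by norm_num) (by norm_num)
      (by norm_num) ?_
    have := hcomm (c 0)
    simp only [add_mul, smul_mul_assoc, o 1 0 (by decide), o 2 0 (by decide), smul_zero,
      add_zero, mul_zero] at this
    rw [zero_smul, zero_smul, zero_add, this]
  have h1 : c 1 * (k x * c 1) = k x * c 1 := by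
    refine peirce_one_of_eigenvector (g := c 2) (i 1) (i 0) (o 1 0 (by decide))
      (by rw [← hs]; abel)
      (a := 1) (b := 0) (d := 3) (by norm_num) (by norm_num) (by norm_num) (by norm_num)
      (by norm_num) ?_
    have := hcomm (c 1)
    simp only [add_mul, smul_mul_assoc, i 1, o 2 1 (by decide), smul_zero, mul_smul_comm,
      add_zero] at this
    rw [zero_smul, add_zero, this]
  have h2 : c 2 * (k x * c 2) = k x * c 2 := by
    refine peirce_one_of_eigenvector (g := c 1) (i 2) (i 0) (o 2 0 (by decide))
      (by rw [← hs]; abel)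
      (a := 3) (b := 0) (d := 1) (by norm_num) (by norm_num) (by norm_num) (by norm_num)
      (by norm_num) ?_
    have := hcomm (c 2)
    simp only [add_mul, smul_mul_assoc, i 2, o 1 2 (by decide), smul_zero, mul_smul_comm,
      zero_add] at this
    rw [zero_smul, add_zero, this, add_comm]
  obtain ⟨r0, hr0⟩ := eq_smul_of_isPrimitive hE (hc.primitive 0) h0
  obtain ⟨r1, hr1⟩ := eq_smul_of_isPrimitive hE (hc.primitive 1) h1
  obtain ⟨r2, hr2⟩ := eq_smul_of_isPrimitive hE (hc.primitive 2) h2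
  refine ⟨![r0, r1, r2], k.symm, fun a b ↦ ?_, ?_⟩
  · rw [LinearEquiv.symm_apply_eq, hk]
    simp
  · rw [LinearEquiv.eq_symm_apply, ← mul_one (k x), ← hs, mul_add, mul_add, hr0, hr1, hr2]
    simp

/-! ### Simplicity and equality of the traces on a frame -/

/-- Otherwise A₁(`c i`) would be an ideal containing `c i` but no other `c j`, against simplicity.
-/
theorem IsFrame.exists_peirce_half [IsSimpleRing A] (hc : IsFrame c) (i : Fin 3) :
    ∃ u, u ≠ 0 ∧ c i * u = (1 / 2 : ℝ) • u := by
  by_contra! hno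
  have hi := (hc.primitive i).idem
  have hidem : ∀ x, c i * (c i * x) = c i * x := by
    intro x
    by_contra hne
    refine hno _ (sub_ne_zero.2 hne) ?_
    have := peirce_cubic hi x
    rw [mul_sub, ← sub_eq_zero]
    have h : (1 / 2 : ℝ) • ((2 : ℝ) • (c i * (c i * (c i * x))) - (3 : ℝ) • (c i * (c i * x)) +
      c i * x) = 0 := by rw [this, smul_zero]
    rw [← h]
    module
  have hmul : ∀ x y, c i * y = y → c i * (x * y) = x * y := by
    intro x y hy
    rw [mul_comm x y, mul_left_comm_of_peirce_one hi hy, ← sub_eq_zero, ← mul_sub]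
    have hz : c i * (c i * x - x) = 0 := by rw [mul_sub, hidem, sub_self]
    have h1 := mul_left_comm_of_peirce_zero hi hz y
    rw [hy, mul_comm _ y, mul_left_comm_of_peirce_one hi hy, hz, mul_zero] at h1
    exact h1.symm
  let I : TwoSidedIdeal A := TwoSidedIdeal.mk' {x | c i * x = x} (mul_zero _)
    (fun {x y} hx hy ↦ by
      change c i * (x + y) = x + y
      rw [mul_add, show c i * x = x from hx, show c i * y = y from hy])
    (fun {x} hx ↦ by
      change c i * -x = -x
      rw [mul_neg, show c i * x = x from hx])
    (fun {x y} hy ↦ hmul x y hy)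
    (fun {x y} hx ↦ by
      change c i * (x * y) = x * y
      rw [mul_comm x y]; exact hmul y x hx)
  have hI : ∀ x, x ∈ I ↔ c i * x = x := fun x ↦ by
    simp only [I, TwoSidedIdeal.mem_mk', Set.mem_ofPred_eq]
  rcases eq_bot_or_eq_top I with h | h
  · exact (hc.primitive i).ne_zero (by simpa [h] using (hI (c i)).2 hi)
  · obtain ⟨j, hj⟩ : ∃ j : Fin 3, i ≠ j := ⟨i + 1, by fin_cases i <;> decide⟩
    have hcj := (hI (c j)).1 (by simp [h])
    rw [hc.orthogonal i j hj] at hcj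
    exact (hc.primitive j).ne_zero hcj.symm

/-- Here u² = ae + bf. The Jordan identity forces a = b, positivity of the form forces a ≠ 0, and
τ(eu²) = ½τ(u²) = τ(fu²) compares the two traces. -/
theorem mulTrace_eq_of_peirce_half [FiniteDimensional ℝ A] (hE : IsEuclidean A) {e f g : A}
    (he : IsPrimitive e) (hf : IsPrimitive f) (hg : g * g = g)
    (hsum : e + f + g = 1) {u : A} (hu0 : u ≠ 0) (heu : e * u = (1 / 2 : ℝ) • u)
    (hfu : f * u = (1 / 2 : ℝ) • u) : mulTrace A e = mulTrace A f := by
  have hgu : g * u = 0 := by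
    have : (e + f + g) * u = u := by rw [hsum, one_mul]
    rw [add_mul, add_mul, heu, hfu] at this
    rw [← sub_eq_zero.2 this]
    module
  have hgq : g * (u * u) = 0 := by
    rw [mul_left_comm_of_peirce_zero hg hgu, hgu, mul_zero]
  obtain ⟨a, ha⟩ := eq_smul_of_isPrimitive hE he (peirce_half_mul_half he.idem heu heu)
  obtain ⟨b, hb⟩ := eq_smul_of_isPrimitive hE hf (peirce_half_mul_half hf.idem hfu hfu)
  have hq : u * u = a • e + b • f := by
    rw [← one_mul (u * u), ← hsum, add_mul, add_mul, hgq, ha, hb, add_zero]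
  have hab : a = b := by
    have h := IsCommJordan.lmul_comm_rmul_rmul u e
    rw [ha, mul_comm u e, heu, hq] at h
    simp only [mul_add, mul_smul_comm, smul_mul_assoc, mul_comm u e, mul_comm u f, heu, hfu] at h
    have h2 : (a - b) • u = 0 := by
      have h3 := congrArg (fun y ↦ (4 : ℝ) • y) h
      rw [← sub_eq_zero] at h3
      rw [← neg_eq_zero, ← h3]
      module
    exact sub_eq_zero.1 ((smul_eq_zero.1 h2).resolve_right hu0)
  have ha0 : a ≠ 0 := by
    rintro rfl
    obtain ⟨B, -, hpos, hassoc⟩ := hE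
    have h := hassoc u 1 u
    rw [mul_one, hq, ← hab] at h
    simp only [zero_smul, add_zero, map_zero] at h
    exact (hpos u hu0).ne' h
  have h1 := mulTrace_mul_half_sq heu
  have h2 := mulTrace_mul_half_sq hfu
  rw [← h2, ha, hb, ← hab, map_smul, map_smul] at h1
  exact mul_left_cancel₀ ha0 h1

/-- The A₁(f) component of u, called p below, is killed by e since A₀(f) · A₁(f) = 0, yet ep = ½p
because L(e) and L(f) commute. So p = 0. -/
theorem peirce_half_mul_orthogonal {e f : A} (he : e * e = e) (hf : f * f = f) (hef : e * f = 0)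
    {u : A} (hu : e * u = (1 / 2 : ℝ) • u) :
    e * (f * u) = (1 / 2 : ℝ) • (f * u) ∧ f * (f * u) = (1 / 2 : ℝ) • (f * u) := by
  have h1 : e * (f * u) = (1 / 2 : ℝ) • (f * u) := by
    rw [mul_left_comm_of_peirce_zero he hef, hu, mul_smul_comm]
  refine ⟨h1, ?_⟩
  have hfe : f * e = 0 := by rw [mul_comm, hef]
  set p := (2 : ℝ) • (f * (f * u)) - f * u with hp
  have hfp : f * p = p := by
    rw [← sub_eq_zero, ← peirce_cubic hf u, hp, mul_sub, mul_smul_comm]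
    module
  have hep0 : e * p = 0 := by
    have h := mul_left_comm_of_peirce_zero hf hfe p
    have h2 := mul_left_comm_of_peirce_one hf hfp e
    rw [hfe, mul_zero, mul_comm p e, mul_left_comm_of_peirce_zero hf hfe, hfp] at h2
    exact h2
  have hep : e * p = (1 / 2 : ℝ) • p := by
    rw [hp, mul_sub, mul_smul_comm, mul_left_comm_of_peirce_zero he hef, h1, mul_smul_comm]
    module
  rw [hep0] at hep
  have hp0 : p = 0 := (smul_eq_zero.1 hep.symm).resolve_left (by norm_num)
  have h := congrArg (fun y ↦ (1 / 2 : ℝ) • y) hp0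
  rw [smul_zero] at h
  rw [← sub_eq_zero, ← h, hp]
  module

theorem mulTrace_eq_or_eq [FiniteDimensional ℝ A] (hE : IsEuclidean A) {e f g : A}
    (he : IsPrimitive e) (hf : IsPrimitive f) (hg : IsPrimitive g) (hef : e * f = 0)
    (hsum : e + f + g = 1) {u : A} (hu0 : u ≠ 0)
    (heu : e * u = (1 / 2 : ℝ) • u) :
    mulTrace A e = mulTrace A f ∨ mulTrace A e = mulTrace A g := by
  by_cases h : f * u = 0
  · right
    have hgu : g * u = (1 / 2 : ℝ) • u := by
      have : (e + f + g) * u = u := by rw [hsum, one_mul]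
      rw [add_mul, add_mul, heu, h] at this
      rw [← sub_eq_zero, ← sub_eq_zero.2 this]
      module
    exact mulTrace_eq_of_peirce_half hE he hg hf.idem (by rw [← hsum]; abel) hu0 heu hgu
  · left
    obtain ⟨h1, h2⟩ := peirce_half_mul_orthogonal he.idem hf.idem hef heu
    exact mulTrace_eq_of_peirce_half hE he hf hg.idem hsum h h1 h2

theorem IsFrame.mulTrace_eq [FiniteDimensional ℝ A] [IsSimpleRing A] (hc : IsFrame c)
    (hE : IsEuclidean A) :
    mulTrace A (c 1) = mulTrace A (c 0) ∧ mulTrace A (c 2) = mulTrace A (c 0) := by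
  have o := hc.orthogonal
  have p := hc.primitive
  obtain ⟨u, hu0, hu⟩ := hc.exists_peirce_half 0
  obtain ⟨v, hv0, hv⟩ := hc.exists_peirce_half 1
  obtain ⟨w, hw0, hw⟩ := hc.exists_peirce_half 2
  have h0 := mulTrace_eq_or_eq hE (p 0) (p 1) (p 2) (o 0 1 (by decide))
    hc.complete hu0 hu
  have h1 := mulTrace_eq_or_eq hE (p 1) (p 0) (p 2) (o 1 0 (by decide))
    (by rw [← hc.complete]; abel) hv0 hv
  have h2 := mulTrace_eq_or_eq hE (p 2) (p 0) (p 1) (o 2 0 (by decide))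
    (by rw [← hc.complete]; abel) hw0 hw
  -- Each of the three traces equals one of the other two, so all agree.
  grind

theorem IsFrame.mulTrace_pos [FiniteDimensional ℝ A] [IsSimpleRing A] (hc : IsFrame c)
    (hE : IsEuclidean A) : 0 < mulTrace A (c 0) := by
  have h := mulTrace_one (A := A)
  rw [← hc.complete, map_add, map_add, (hc.mulTrace_eq hE).1, (hc.mulTrace_eq hE).2] at h
  have : Nontrivial A := ⟨c 0, 0, (hc.primitive 0).ne_zero⟩
  have : (0 : ℝ) < Module.finrank ℝ A := by exact_mod_cast Module.finrank_pos
  linarith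

/-! ### Power sums and the determinant -/

/-- The power sums of the eigenvalues are the normalized traces of the powers. -/
theorem HasSpectrum.mulTrace_powers [FiniteDimensional ℝ A] [IsSimpleRing A] (hc : IsFrame c)
    (hE : IsEuclidean A) {x : A} {l : Fin 3 → ℝ} (h : HasSpectrum c x l) :
    mulTrace A x = (l 0 + l 1 + l 2) * mulTrace A (c 0) ∧
    mulTrace A (x * x) = (l 0 ^ 2 + l 1 ^ 2 + l 2 ^ 2) * mulTrace A (c 0) ∧
    mulTrace A (x * (x * x)) = (l 0 ^ 3 + l 1 ^ 3 + l 2 ^ 3) * mulTrace A (c 0) := by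
  obtain ⟨k, hk, rfl⟩ := h
  obtain ⟨h1, h2⟩ := hc.mulTrace_eq hE
  have o := hc.orthogonal
  have i := fun j ↦ (hc.primitive j).idem
  rw [← hk, ← hk, mulTrace_map k hk, mulTrace_map k hk, mulTrace_map k hk]
  simp only [add_mul, mul_add, smul_mul_assoc, mul_smul_comm, i, o 0 1 (by decide),
    o 0 2 (by decide), o 1 0 (by decide), o 1 2 (by decide), o 2 0 (by decide),
    o 2 1 (by decide), smul_zero, add_zero, zero_add, map_add, map_smul, smul_eq_mul, h1, h2]
  refine ⟨trivial, by ring, by ring⟩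

theorem hasSpectrum_eigenvalues [FiniteDimensional ℝ A] (hc : IsFrame c) (hE : IsEuclidean A)
    (x : A) : HasSpectrum c x (eigenvalues c x) := by
  have h := hc.exists_hasSpectrum hE x
  rw [eigenvalues, dif_pos h]
  exact h.choose_spec

theorem tr_mul_mulTrace [FiniteDimensional ℝ A] [IsSimpleRing A] (hc : IsFrame c)
    (hE : IsEuclidean A) (x : A) : tr c x * mulTrace A (c 0) = mulTrace A x :=
  ((hasSpectrum_eigenvalues hc hE x).mulTrace_powers hc hE).1.symm

end FrameSpectrum

end JordanAlg

/-- The frame `c₁, c₂, c₃` is indexed by `0, 1, 2 : Fin 3`, so that `c 0 + c 1` is `e₀` and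
`c 2` is `c₃`. -/
theorem lemma1 {A : Type*} [NonAssocCommRing A] [Module ℝ A] [IsScalarTower ℝ A A]
    [SMulCommClass ℝ A A] [FiniteDimensional ℝ A] [IsCommJordan A] [IsSimpleRing A]
    (hE : JordanAlg.IsEuclidean A) (hrank : JordanAlg.rank A = 3)
    (c : Fin 3 → A) (hc : JordanAlg.IsFrame c)
    (ξ : A) (hξ : ξ ∈ JordanAlg.peirceSpace (c 2) (1 / 2)) (t : ℝ) :
    JordanAlg.det c ((c 0 + c 1) + ξ + t • c 2) = t - 1 / 2 * JordanAlg.normSq c ξ := by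
  have hξ : c 2 * ξ = (1 / 2 : ℝ) • ξ := by
    simpa [JordanAlg.peirceSpace, Module.End.mem_eigenspace_iff] using hξ
  have i2 := (hc.primitive 2).idem
  obtain ⟨h1, h2⟩ := hc.mulTrace_eq hE
  have hpos := hc.mulTrace_pos hE
  have hN := JordanAlg.tr_mul_mulTrace hc hE (ξ * ξ)
  have he : c 0 + c 1 = 1 - c 2 := by rw [← hc.complete]; abel
  have hone : JordanAlg.mulTrace A 1 = 3 * JordanAlg.mulTrace A (c 0) := by
    rw [← hc.complete, map_add, map_add, h1, h2]; ring
  have hT := JordanAlg.mulTrace_peirce_half i2 hξ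
  have hT2 := JordanAlg.mulTrace_mul_half_sq hξ
  have hT3 := JordanAlg.mulTrace_half_cube i2 hξ
  obtain ⟨p1, p2, p3⟩ := (JordanAlg.hasSpectrum_eigenvalues hc hE
    ((c 0 + c 1) + ξ + t • c 2)).mulTrace_powers hc hE
  simp only [he, add_mul, mul_add, sub_mul, mul_sub, one_mul, mul_one, smul_mul_assoc,
    mul_smul_comm, mul_comm _ (c 2), hξ, i2, map_add, map_sub, map_smul,
    smul_eq_mul, hone, h2, hT, hT2, hT3, ← hN] at p1 p2 p3
  rw [← he] at p1 p2 p3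
  rw [JordanAlg.normSq, JordanAlg.trInner, JordanAlg.det]
  set l := JordanAlg.eigenvalues c ((c 0 + c 1) + ξ + t • c 2)
  set n := JordanAlg.tr c (ξ * ξ)
  -- The positive factor τ(c 0) cancels from each trace identity.
  have e1 : l 0 + l 1 + l 2 = 2 + t :=
    mul_right_cancel₀ hpos.ne' (by linear_combination -p1)
  have e2 : l 0 ^ 2 + l 1 ^ 2 + l 2 ^ 2 = 2 + t ^ 2 + n :=
    mul_right_cancel₀ hpos.ne' (by linear_combination -p2)
  have e3 : l 0 ^ 3 + l 1 ^ 3 + l 2 ^ 3 = 2 + t ^ 3 + 3 / 2 * (1 + t) * n :=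
    mul_right_cancel₀ hpos.ne' (by linear_combination -p3)
  have newton : 6 * (l 0 * l 1 * l 2) = (l 0 + l 1 + l 2) ^ 3 -
      3 * (l 0 + l 1 + l 2) * (l 0 ^ 2 + l 1 ^ 2 + l 2 ^ 2) +
      2 * (l 0 ^ 3 + l 1 ^ 3 + l 2 ^ 3) := by ring
  rw [e1, e2, e3] at newton
  linear_combination newton / 6
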